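/- Call a finite, finitely supported positive measure $\eta$ on $\mathbb R$ admissible if $\int e^{x}\,\eta(dx)=1$ and $\int e^{-x}\,\eta(dx)=1$, and for such a measure put $$T(\eta)=\frac12\int_{\mathbb R}\left|e^{x}-e^{-x}\right|\eta(dx).$$ Write $\eta_1*\cdots*\eta_n$ for the convolution of finite measures on $\mathbb R$ and $\eta^{*n}$ for the $n$-fold convolution of $\eta$ with itself. For $\varepsilon>0$ define $$\Delta(\varepsilon)=\sqrt{(1+6\varepsilon)\,\frac{\sinh(2\varepsilon)-2\varepsilon}{(2\varepsilon)^2}}$$ and, when $\Delta(\varepsilon)<1$, $$C(\varepsilon)=\max\left\{\frac{4\sqrt2+\Delta(\varepsilon)}{1-\Delta(\varepsilon)},\ \sqrt{\frac{1+e^{-\varepsilon}}{1-e^{-\varepsilon}}}\right\},$$ and let $C_0=\inf\{C(\varepsilon):\varepsilon>0,\ \Delta(\varepsilon)<1\}$. This infimum is a real number, taken over a non-empty set that is bounded below, and $C_0<6.7129$. Moreover, for every integer $n\ge1$ and all admissible measures $\eta_1,\dots,\eta_n$ on $\mathbb R$, $$T\left(\Big(\frac1n\sum_{i=1}^n\eta_i\Big)^{*n}\right)\le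 C_0\,T(\eta_1*\cdots*\eta_n).$$ -/

import Mathlib

open MeasureTheory

namespace AdmissibleConv

/-- A measure `η` on the real line is admissible if it is finite and finitely supported (it is
carried by a finite set of points) and `∫ eˣ dη = ∫ e⁻ˣ dη = 1`. -/
structure IsAdmissible (η : Measure ℝ) : Prop where
  isFiniteMeasure : IsFiniteMeasure η
  finite_support : ∃ s : Set ℝ, s.Finite ∧ η sᶜ = 0
  integral_exp : ∫ x, Real.exp x ∂η = 1
  integral_exp_neg : ∫ x, Real.exp (-x) ∂η = 1

/-- The functional `T(η) = ½ ∫ |eˣ - e⁻ˣ| dη`. -/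
noncomputable def T (η : Measure ℝ) : ℝ :=
  (1 / 2) * ∫ x, |Real.exp x - Real.exp (-x)| ∂η

/-- The convolution `η₁ * ⋯ * ηₙ` of finite measures on the real line: the image of the product
measure `η₁ ⊗ ⋯ ⊗ ηₙ` under addition `(x₁, …, xₙ) ↦ x₁ + ⋯ + xₙ`. -/
noncomputable def familyConv {n : ℕ} (η : Fin n → Measure ℝ) : Measure ℝ :=
  (Measure.pi η).map (fun x : Fin n → ℝ => ∑ i, x i)

/-- The `n`-fold convolution `η * ⋯ * η` of a single measure. -/
noncomputable def convPower (η : Measure ℝ) (n : ℕ) : Measure ℝ :=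
  familyConv (fun _ : Fin n => η)

/-- The arithmetic mean `(η₁ + ⋯ + ηₙ) / n` of a family of measures. -/
noncomputable def mean {n : ℕ} (η : Fin n → Measure ℝ) : Measure ℝ :=
  (n : ENNReal)⁻¹ • ∑ i, η i

/-- `Δ(ε) = √((1 + 6ε) (sinh(2ε) - 2ε) / (2ε)²)`, used for `ε > 0`. -/
noncomputable def Delta (ε : ℝ) : ℝ :=
  Real.sqrt ((1 + 6 * ε) * ((Real.sinh (2 * ε) - 2 * ε) / (2 * ε) ^ 2))

/-- `C(ε)`, the larger of `(4√2 + Δ(ε)) / (1 - Δ(ε))` and `√((1 + e^{-ε}) / (1 - e^{-ε}))`,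
used for `ε > 0` with `Δ(ε) < 1`. -/
noncomputable def C (ε : ℝ) : ℝ :=
  max ((4 * Real.sqrt 2 + Delta ε) / (1 - Delta ε))
    (Real.sqrt ((1 + Real.exp (-ε)) / (1 - Real.exp (-ε))))

/-- The set of values `C(ε)` over all `ε > 0` with `Δ(ε) < 1`. -/
def CValues : Set ℝ :=
  {c : ℝ | ∃ ε : ℝ, 0 < ε ∧ Delta ε < 1 ∧ c = C ε}

/-- The constant `C₀ = inf {C(ε) : ε > 0, Δ(ε) < 1}`. -/
noncomputable def C₀ : ℝ := sInf CValues

end AdmissibleConv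

/-!
Write `w i` for the weights of `η i` on a common finite set of atoms. With the probability weights
`m i = w i · cosh` and `t = tanh`, which is centred under each `m i`, the identity
`eʸ = cosh y (1 + tanh y)` turns `T (η₁ * ⋯ * ηₙ)` into the expectation of
`|∏ (1 + tᵢ) - ∏ (1 - tᵢ)| / 2` for independent `tᵢ`. The same holds for the averaged measure, with
the averaged weights, and both products have the same variance sum `s = ∑ E tᵢ²`.

If the Hellinger affinity `∏ ηᵢ(ℝ)` is at most `e^{-ε}`, the classical bounds of `T` by the affinity
(`one_sub_prod_le_discreteT`, `discreteT_sq_le`) and the inequality of means give the constant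
`√((1 + e^{-ε}) / (1 - e^{-ε}))`.

Otherwise `s ≤ 2 ε`, and the linear part `L = ∑ tᵢ` dominates. The nonlinear remainder has second
moment at most `sinh s - s` (`prodExp_remainder_sq_le`), while `E|L| ≥ s / √(1 + 3 s)` by the fourth
moment method (`sq_variance_le`), so the remainder costs at most `Δ(ε) E|L|` on each side. The
linear parts are compared by `prodExp_abs_sum_meanWeight_le_two_mul`: averaging the laws at most
doubles `E|L|`. This follows from `K |x| = ∫ (1 - cos (u x)) / u² du`: after symmetrisation the
characteristic functions are nonnegative, and the inequality of means bounds their product by the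
power of their average. Altogether the ratio is at most `(2 + Δ) / (1 - Δ)`, which is below the
first term `(4√2 + Δ) / (1 - Δ)` of `C(ε)`.

The numerical bound on `C₀` is read off at `ε = 0.04439`, close to the point where the two terms of
`C(ε)` cross.
-/

namespace AdmissibleConv

open Finset

variable {n : ℕ} {α β : Type*} [Fintype α] [Fintype β]

/-! ### Expectations over independent finite families and moments -/

/-- The sum of `g` over all `x : Fin n → α` against the product weights `∏ i, m i (x i)`. If each
`m i` is a probability vector this is the expectation of `g` at a vector of independent outcomes
`x i` with laws `m i`; the weights are not required to be normalised. -/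
def prodExp (m : Fin n → α → ℝ) (g : (Fin n → α) → ℝ) : ℝ :=
  ∑ x, (∏ i, m i (x i)) * g x

theorem prodExp_add (m : Fin n → α → ℝ) (f g : (Fin n → α) → ℝ) :
    prodExp m (fun x => f x + g x) = prodExp m f + prodExp m g := by
  simp only [prodExp, mul_add, sum_add_distrib]

theorem prodExp_sub (m : Fin n → α → ℝ) (f g : (Fin n → α) → ℝ) :
    prodExp m (fun x => f x - g x) = prodExp m f - prodExp m g := by
  simp only [prodExp, mul_sub, sum_sub_distrib]

theorem prodExp_const_mul (m : Fin n → α → ℝ) (c : ℝ) (g : (Fin n → α) → ℝ) :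
    prodExp m (fun x => c * g x) = c * prodExp m g := by
  simp only [prodExp, mul_sum]
  exact sum_congr rfl fun x _ => by ring

theorem prodExp_sum {κ : Type*} (s : Finset κ) (m : Fin n → α → ℝ)
    (g : κ → (Fin n → α) → ℝ) :
    prodExp m (fun x => ∑ k ∈ s, g k x) = ∑ k ∈ s, prodExp m (g k) := by
  simp only [prodExp, mul_sum]
  exact sum_comm

theorem prodExp_mono {m : Fin n → α → ℝ} (hm : ∀ i a, 0 ≤ m i a) {f g : (Fin n → α) → ℝ}
    (h : ∀ x, f x ≤ g x) : prodExp m f ≤ prodExp m g :=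
  sum_le_sum fun x _ => mul_le_mul_of_nonneg_left (h x) (prod_nonneg fun i _ => hm i _)

theorem prodExp_nonneg {m : Fin n → α → ℝ} (hm : ∀ i a, 0 ≤ m i a) {f : (Fin n → α) → ℝ}
    (h : ∀ x, 0 ≤ f x) : 0 ≤ prodExp m f :=
  sum_nonneg fun x _ => mul_nonneg (prod_nonneg fun i _ => hm i _) (h x)

theorem prodExp_prod (m f : Fin n → α → ℝ) :
    prodExp m (fun x => ∏ i, f i (x i)) = ∏ i, ∑ a, m i a * f i a := by
  simp only [prodExp, ← prod_mul_distrib]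
  exact (Fintype.prod_sum fun i a => m i a * f i a).symm

theorem prodExp_const (m : Fin n → α → ℝ) (c : ℝ) :
    prodExp m (fun _ => c) = (∏ i, ∑ a, m i a) * c := by
  have h := prodExp_prod m (fun _ _ => 1)
  simp only [prod_const_one, mul_one] at h
  rw [← h, mul_comm, ← prodExp_const_mul]
  simp

theorem prodExp_mul_prod (m f : Fin n → α → ℝ) (j : Fin n) (h : α → ℝ) :
    prodExp m (fun x => h (x j) * ∏ i, f i (x i)) =
      ∏ i, if i = j then ∑ a, m i a * (h a * f i a) else ∑ a, m i a * f i a := by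
  have e := prodExp_prod m (fun i a => (if i = j then h a else 1) * f i a)
  have e2 : ∀ x : Fin n → α, ∏ i, (if i = j then h (x i) else 1) * f i (x i) =
      h (x j) * ∏ i, f i (x i) := by
    intro x
    rw [prod_mul_distrib, prod_ite_eq' univ j]
    simp
  simp only [e2] at e
  rw [e]
  refine prod_congr rfl fun i _ => ?_
  split_ifs <;> simp

/-- If all the other factors have mean one, only the factor at the distinguished index survives. -/
theorem prodExp_mul_prod_of_one (m f : Fin n → α → ℝ) (j : Fin n) (h : α → ℝ)
    (hf : ∀ i, ∑ a, m i a * f i a = 1) :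
    prodExp m (fun x => h (x j) * ∏ i, f i (x i)) = ∑ a, m j a * (h a * f j a) := by
  rw [prodExp_mul_prod]
  simp only [hf]
  rw [prod_ite_eq' univ j]
  simp

/-- No normalisation of the weights at the other indices is needed. -/
theorem prodExp_eval_eq_zero (m : Fin n → α → ℝ) (j : Fin n) (h : α → ℝ)
    (h0 : ∑ a, m j a * h a = 0) : prodExp m (fun x => h (x j)) = 0 := by
  have e := prodExp_mul_prod m (fun _ _ => 1) j h
  simp only [prod_const_one, mul_one] at e
  rw [e]
  exact prod_eq_zero (mem_univ j) (by simp [h0])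

/-- Fubini: the outcome with index `0` is summed separately. -/
theorem prodExp_succ (m : Fin (n + 1) → α → ℝ) (g : (Fin (n + 1) → α) → ℝ) :
    prodExp m g =
      ∑ a, m 0 a * prodExp (fun i => m i.succ) (fun x => g (Fin.cons a x)) := by
  simp only [prodExp, mul_sum]
  rw [← Fintype.sum_prod_type' (f := fun a (x : Fin n → α) =>
    m 0 a * ((∏ i : Fin n, m i.succ (x i)) * g (Fin.cons a x)))]
  refine (Fintype.sum_equiv (Fin.consEquiv fun _ : Fin (n + 1) => α) _ _ fun p => ?_).symm
  simp [Fin.consEquiv, Fin.prod_univ_succ, mul_assoc]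

/-- Cauchy-Schwarz. -/
theorem prodExp_mul_sq_le {m : Fin n → α → ℝ} (hm : ∀ i a, 0 ≤ m i a)
    {f g h : (Fin n → α) → ℝ} (hf : ∀ x, 0 ≤ f x) (hg : ∀ x, 0 ≤ g x)
    (hfg : ∀ x, h x ^ 2 ≤ f x * g x) :
    prodExp m h ^ 2 ≤ prodExp m f * prodExp m g := by
  refine sum_sq_le_sum_mul_sum_of_sq_le_mul univ
    (fun x _ => mul_nonneg (prod_nonneg fun i _ => hm i _) (hf x))
    (fun x _ => mul_nonneg (prod_nonneg fun i _ => hm i _) (hg x)) fun x _ => ?_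
  have h2 := mul_le_mul_of_nonneg_left (hfg x) (sq_nonneg (∏ i, m i (x i)))
  nlinarith [h2]

theorem prodExp_abs_sq_le {m : Fin n → α → ℝ} (hm : ∀ i a, 0 ≤ m i a)
    (h1 : ∀ i, ∑ a, m i a = 1) (h : (Fin n → α) → ℝ) :
    prodExp m (fun x => |h x|) ^ 2 ≤ prodExp m (fun x => h x ^ 2) := by
  have := prodExp_mul_sq_le hm (f := fun _ => 1) (g := fun x => h x ^ 2) (h := fun x => |h x|)
    (fun _ => zero_le_one) (fun x => sq_nonneg _) (fun x => by simp)
  rwa [prodExp_const, prod_congr rfl fun i _ => h1 i, prod_const_one, one_mul, one_mul] at this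

/-- Moments of a sum of independent centred variables bounded by one: the variances add up, and
the fourth moment is at most `s + 3 s²`, where `s` is the variance of the sum. -/
theorem moments_sum (t : α → ℝ) (ht : ∀ a, |t a| ≤ 1) :
    ∀ {n : ℕ} (m : Fin n → α → ℝ), (∀ i a, 0 ≤ m i a) → (∀ i, ∑ a, m i a = 1) →
      (∀ i, ∑ a, m i a * t a = 0) →
      prodExp m (fun x => ∑ i, t (x i)) = 0 ∧
      prodExp m (fun x => (∑ i, t (x i)) ^ 2) = ∑ i, ∑ a, m i a * t a ^ 2 ∧
      prodExp m (fun x => (∑ i, t (x i)) ^ 4) ≤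
        (∑ i, ∑ a, m i a * t a ^ 2) + 3 * (∑ i, ∑ a, m i a * t a ^ 2) ^ 2 := by
  intro n
  induction n with
  | zero => intro m _ _ _; simp [prodExp]
  | succ n ih =>
    intro m hm h1 h0
    obtain ⟨e1, e2, e4⟩ := ih (fun i => m i.succ) (fun i => hm _) (fun i => h1 _) fun i => h0 _
    set s := ∑ i : Fin n, ∑ a, m i.succ a * t a ^ 2 with hs
    set E := prodExp (fun i : Fin n => m i.succ) with hE
    set τ := ∑ a, m 0 a * t a ^ 2 with hτ
    have ec : ∀ c, E (fun _ => c) = c := fun c => by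
      rw [hE, prodExp_const, prod_congr rfl fun i _ => h1 _, prod_const_one, one_mul]
    have ea : ∀ f g, E (fun x => f x + g x) = E f + E g := prodExp_add _
    have em : ∀ c g, E (fun x => c * g x) = c * E g := prodExp_const_mul _
    set S : (Fin n → α) → ℝ := fun x => ∑ i, t (x i) with hS
    have q1 : ∀ c, E (fun x => c + S x) = c := fun c => by rw [ea, ec, e1, add_zero]
    have q2 : ∀ c, E (fun x => (c + S x) ^ 2) = c ^ 2 + s := fun c => by
      have : (fun x => (c + S x) ^ 2) = fun x => (c ^ 2 + 2 * c * S x) + S x ^ 2 := by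
        funext x; ring
      rw [this, ea, ea, ec, em, e1, e2]; ring
    have q4 : ∀ c, E (fun x => (c + S x) ^ 4) =
        c ^ 4 + 6 * c ^ 2 * s + 4 * c * E (fun x => S x ^ 3) + E (fun x => S x ^ 4) := fun c => by
      have : (fun x => (c + S x) ^ 4) = fun x => (((c ^ 4 + 4 * c ^ 3 * S x) +
          6 * c ^ 2 * S x ^ 2) + 4 * c * S x ^ 3) + S x ^ 4 := by
        funext x; ring
      rw [this, ea, ea, ea, ea, ec, em, em, em, e1, e2]; ring
    have hs0 : 0 ≤ s := sum_nonneg fun i _ => sum_nonneg fun a _ =>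
      mul_nonneg (hm _ _) (sq_nonneg _)
    simp only [prodExp_succ, Fin.sum_univ_succ, Fin.cons_zero, Fin.cons_succ]
    change ∑ a, m 0 a * E (fun x => t a + S x) = 0 ∧
      ∑ a, m 0 a * E (fun x => (t a + S x) ^ 2) = τ + s ∧
      ∑ a, m 0 a * E (fun x => (t a + S x) ^ 4) ≤ (τ + s) + 3 * (τ + s) ^ 2
    simp only [q1, q2, q4]
    refine ⟨h0 0, ?_, ?_⟩
    · simp only [mul_add, sum_add_distrib, ← sum_mul, h1, one_mul]
      rfl
    · have hb : ∑ a, m 0 a * t a ^ 4 ≤ τ := by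
        refine sum_le_sum fun a _ => mul_le_mul_of_nonneg_left ?_ (hm _ _)
        have h2 : t a ^ 2 ≤ 1 := (sq_le_one_iff_abs_le_one _).2 (ht a)
        nlinarith [sq_nonneg (t a)]
      have hx : ∑ a, m 0 a * (t a ^ 4 + 6 * t a ^ 2 * s + 4 * t a * E (fun x => S x ^ 3) +
          E (fun x => S x ^ 4)) = ∑ a, m 0 a * t a ^ 4 + 6 * s * τ +
          4 * E (fun x => S x ^ 3) * (∑ a, m 0 a * t a) +
          (∑ a, m 0 a) * E (fun x => S x ^ 4) := by
        clear_value s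
        rw [hτ, mul_sum, mul_sum, sum_mul, ← sum_add_distrib, ← sum_add_distrib,
          ← sum_add_distrib]
        exact sum_congr rfl fun a _ => by ring
      rw [hx, h0, h1]
      nlinarith [sq_nonneg τ]

/-- A lower bound for the first absolute moment from the second and fourth moments: Hölder's
inequality `(E L²)³ ≤ (E|L|)² E L⁴`. -/
theorem sq_variance_le (t : α → ℝ) (ht : ∀ a, |t a| ≤ 1) (m : Fin n → α → ℝ)
    (hm : ∀ i a, 0 ≤ m i a) (h1 : ∀ i, ∑ a, m i a = 1) (h0 : ∀ i, ∑ a, m i a * t a = 0) {s : ℝ}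
    (hs : s = ∑ i, ∑ a, m i a * t a ^ 2) :
    s ^ 2 ≤ prodExp m (fun x => |∑ i, t (x i)|) ^ 2 * (1 + 3 * s) := by
  obtain ⟨-, e2, e4⟩ := moments_sum t ht m hm h1 h0
  rw [← hs] at e2 e4
  have hs0 : 0 ≤ s := hs ▸ sum_nonneg fun i _ => sum_nonneg fun a _ =>
      mul_nonneg (hm _ _) (sq_nonneg _)
  rcases hs0.eq_or_lt with h | hpos
  · rw [← h]
    simpa using sq_nonneg (prodExp m fun x => |∑ i, t (x i)|)
  set S : (Fin n → α) → ℝ := fun x => ∑ i, t (x i) with hS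
  have c1 := prodExp_mul_sq_le hm (f := fun x => |S x|) (g := fun x => |S x| ^ 3)
    (h := fun x => S x ^ 2) (fun x => abs_nonneg _) (fun x => by positivity)
    (fun x => by rw [← sq_abs (S x)]; exact le_of_eq (by ring))
  have c2 := prodExp_mul_sq_le hm (f := fun x => S x ^ 2) (g := fun x => S x ^ 4)
    (h := fun x => |S x| ^ 3) (fun x => sq_nonneg _) (fun x => by positivity)
    (fun x => by rw [← pow_mul, pow_mul', sq_abs]; exact le_of_eq (by ring))
  change prodExp m (fun x => S x ^ 2) = s at e2
  change prodExp m (fun x => S x ^ 4) ≤ _ at e4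
  change s ^ 2 ≤ prodExp m (fun x => |S x|) ^ 2 * _
  rw [e2] at c1 c2
  set A := prodExp m (fun x => |S x|)
  set B := prodExp m (fun x => |S x| ^ 3)
  have d2 : B ^ 2 ≤ s * (s + 3 * s ^ 2) := c2.trans (mul_le_mul_of_nonneg_left e4 hs0)
  have d1 : (s ^ 2) ^ 2 ≤ A ^ 2 * B ^ 2 := by
    rw [← mul_pow]; exact pow_le_pow_left₀ (sq_nonneg s) c1 2
  have d3 := d1.trans (mul_le_mul_of_nonneg_left d2 (sq_nonneg A))
  have : s ^ 2 * s ^ 2 ≤ s ^ 2 * (A ^ 2 * (1 + 3 * s)) := by nlinarith [d3]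
  exact le_of_mul_le_mul_left this (by positivity)

/-- The odd part of `∏ (1 + τᵢ)` is at most `sinh (∑ τᵢ)`. The bound of the even part by `cosh` is
carried along because the induction step, by the addition formulas, mixes the two. -/
theorem prod_one_add_sub_le_sinh :
    ∀ {n : ℕ} (τ : Fin n → ℝ), (∀ i, 0 ≤ τ i) →
      (∏ i, (1 + τ i) - ∏ i, (1 - τ i)) / 2 ≤ Real.sinh (∑ i, τ i) ∧
      (∏ i, (1 + τ i) + ∏ i, (1 - τ i)) / 2 ≤ Real.cosh (∑ i, τ i) := by
  intro n
  induction n with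
  | zero => intro τ _; simp
  | succ n ih =>
    intro τ hτ
    obtain ⟨hs, hc⟩ := ih (fun i => τ i.succ) fun i => hτ _
    simp only [Fin.prod_univ_succ, Fin.sum_univ_succ, Real.sinh_add, Real.cosh_add]
    set P := ∏ i : Fin n, (1 + τ i.succ)
    set Q := ∏ i : Fin n, (1 - τ i.succ)
    set S := ∑ i : Fin n, τ i.succ
    have hS : 0 ≤ S := sum_nonneg fun i _ => hτ _
    have g1 := Real.self_le_sinh_iff.2 (hτ 0)
    have g2 := Real.one_le_cosh (τ 0)
    have g3 := Real.sinh_nonneg_iff.2 hS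
    have g4 := Real.cosh_pos S
    have h0 := hτ 0
    constructor
    · nlinarith [mul_le_mul_of_nonneg_left hc h0, mul_le_mul_of_nonneg_right g1 g4.le,
        mul_le_mul_of_nonneg_right g2 g3]
    · nlinarith [mul_le_mul_of_nonneg_left hs h0, mul_le_mul_of_nonneg_right g1 g3,
        mul_le_mul_of_nonneg_right g2 g4.le]

/-- The second moment of what remains of `(∏ (1 + tᵢ) - ∏ (1 - tᵢ)) / 2` after its linear part
`∑ tᵢ` is removed. -/
theorem prodExp_remainder_sq_le (t : α → ℝ) (ht : ∀ a, |t a| ≤ 1) (m : Fin n → α → ℝ)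
    (hm : ∀ i a, 0 ≤ m i a) (h1 : ∀ i, ∑ a, m i a = 1) (h0 : ∀ i, ∑ a, m i a * t a = 0) {s : ℝ}
    (hs : s = ∑ i, ∑ a, m i a * t a ^ 2) :
    prodExp m (fun x => ((∏ i, (1 + t (x i)) - ∏ i, (1 - t (x i))) / 2 - ∑ i, t (x i)) ^ 2) ≤
      Real.sinh s - s := by
  obtain ⟨-, e2, -⟩ := moments_sum t ht m hm h1 h0
  rw [← hs] at e2
  set τ : Fin n → ℝ := fun i => ∑ a, m i a * t a ^ 2 with hτ
  have i1 : ∀ i, ∑ a, m i a * (1 + t a) = 1 := fun i => by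
    simp only [mul_add, mul_one, sum_add_distrib, h1, h0, add_zero]
  have i2 : ∀ i, ∑ a, m i a * (1 - t a) = 1 := fun i => by
    simp only [mul_sub, mul_one, sum_sub_distrib, h1, h0, sub_zero]
  have p1 : prodExp m (fun x => ∏ i, (1 + t (x i)) ^ 2) = ∏ i, (1 + τ i) := by
    rw [prodExp_prod m fun _ a => (1 + t a) ^ 2]
    refine prod_congr rfl fun i _ => ?_
    have : ∀ a, m i a * (1 + t a) ^ 2 = m i a + 2 * (m i a * t a) + m i a * t a ^ 2 :=
      fun a => by ring
    simp only [this, sum_add_distrib, ← mul_sum, h1, h0, hτ]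
    ring
  have p2 : prodExp m (fun x => ∏ i, (1 - t (x i)) ^ 2) = ∏ i, (1 + τ i) := by
    rw [prodExp_prod m fun _ a => (1 - t a) ^ 2]
    refine prod_congr rfl fun i _ => ?_
    have : ∀ a, m i a * (1 - t a) ^ 2 = m i a - 2 * (m i a * t a) + m i a * t a ^ 2 :=
      fun a => by ring
    simp only [this, sum_add_distrib, sum_sub_distrib, ← mul_sum, h1, h0, hτ]
    ring
  have p3 : prodExp m (fun x => ∏ i, ((1 + t (x i)) * (1 - t (x i)))) = ∏ i, (1 - τ i) := by
    rw [prodExp_prod m fun _ a => (1 + t a) * (1 - t a)]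
    refine prod_congr rfl fun i _ => ?_
    have : ∀ a, m i a * ((1 + t a) * (1 - t a)) = m i a - m i a * t a ^ 2 :=
      fun a => by ring
    simp only [this, sum_sub_distrib, h1, hτ]
  have c1 : ∀ j, prodExp m (fun x => t (x j) * ∏ i, (1 + t (x i))) = τ j := fun j => by
    rw [prodExp_mul_prod_of_one m (fun _ a => 1 + t a) j t i1]
    have : ∀ a, m j a * (t a * (1 + t a)) = m j a * t a + m j a * t a ^ 2 := fun a => by ring
    simp only [this, sum_add_distrib, h0, hτ, zero_add]
  have c2 : ∀ j, prodExp m (fun x => t (x j) * ∏ i, (1 - t (x i))) = -τ j := fun j => by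
    rw [prodExp_mul_prod_of_one m (fun _ a => 1 - t a) j t i2]
    have : ∀ a, m j a * (t a * (1 - t a)) = m j a * t a - m j a * t a ^ 2 := fun a => by ring
    simp only [this, sum_sub_distrib, h0, hτ, zero_sub]
  have d1 : prodExp m (fun x => (∑ j, t (x j)) * ∏ i, (1 + t (x i))) = s := by
    simp only [sum_mul, prodExp_sum, c1, hs, hτ]
  have d2 : prodExp m (fun x => (∑ j, t (x j)) * ∏ i, (1 - t (x i))) = -s := by
    simp only [sum_mul, prodExp_sum, c2, hs, hτ, sum_neg_distrib]
  have key : (fun x : Fin n → α =>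
      ((∏ i, (1 + t (x i)) - ∏ i, (1 - t (x i))) / 2 - ∑ i, t (x i)) ^ 2) =
      fun x => (1 / 4 * ∏ i, (1 + t (x i)) ^ 2 + 1 / 4 * ∏ i, (1 - t (x i)) ^ 2 +
        (-1 / 2) * ∏ i, ((1 + t (x i)) * (1 - t (x i))) +
        (-1) * ((∑ j, t (x j)) * ∏ i, (1 + t (x i))) +
        1 * ((∑ j, t (x j)) * ∏ i, (1 - t (x i)))) + (∑ i, t (x i)) ^ 2 := by
    funext x
    rw [prod_mul_distrib, prod_pow, prod_pow]
    ring
  have hsinh := (prod_one_add_sub_le_sinh τ fun i => sum_nonneg fun a _ =>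
      mul_nonneg (hm _ _) (sq_nonneg _)).1
  rw [key]
  simp only [prodExp_add, prodExp_const_mul, p1, p2, p3, d1, d2, e2]
  change _ ≤ Real.sinh (∑ i, ∑ a, m i a * t a ^ 2) at hsinh
  rw [← hs] at hsinh
  linarith

/-! ### The linear part: characteristic functions and symmetrisation -/

theorem integrableOn_one_sub_cos_div_sq :
    IntegrableOn (fun u : ℝ => (1 - Real.cos u) / u ^ 2) (Set.Ioi 0) := by
  have hmeas : Measurable fun u : ℝ => (1 - Real.cos u) / u ^ 2 := by fun_prop
  rw [← Set.Ioc_union_Ioi_eq_Ioi (zero_le_one' ℝ)]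
  refine IntegrableOn.union ?_ ?_
  · refine Measure.integrableOn_of_bounded (M := 1 / 2) (by simp)
      hmeas.aestronglyMeasurable ?_
    refine (ae_restrict_iff' measurableSet_Ioc).2 (.of_forall fun u hu => ?_)
    have h1 := Real.one_sub_sq_div_two_le_cos (x := u)
    have h2 := Real.cos_le_one u
    have h3 : 0 < u ^ 2 := pow_pos hu.1 2
    rw [Real.norm_of_nonneg (div_nonneg (by linarith) h3.le), div_le_iff₀ h3]
    linarith
  · refine Integrable.mono' (g := fun u : ℝ => 2 * u ^ (-2 : ℝ))
      ((integrableOn_Ioi_rpow_of_lt (by norm_num) one_pos).const_mul 2)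
      hmeas.aestronglyMeasurable ?_
    refine (ae_restrict_iff' measurableSet_Ioi).2 (.of_forall fun u hu => ?_)
    have h1 := Real.neg_one_le_cos u
    have h2 := Real.cos_le_one u
    have hu0 : (0 : ℝ) < u := one_pos.trans hu
    have h3 : 0 < u ^ 2 := pow_pos hu0 2
    rw [Real.norm_of_nonneg (div_nonneg (by linarith) h3.le), Real.rpow_neg hu0.le,
      Real.rpow_two, ← div_eq_mul_inv]
    gcongr
    linarith

/-- The constant in `∫₀^∞ (1 - cos (u x)) / u² du = K |x|`; only its positivity is needed. -/
noncomputable def absConst : ℝ := ∫ u in Set.Ioi (0 : ℝ), (1 - Real.cos u) / u ^ 2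

theorem absConst_pos : 0 < absConst := by
  have h0 : ∀ u : ℝ, 0 ≤ (1 - Real.cos u) / u ^ 2 := fun u =>
    div_nonneg (by linarith [Real.cos_le_one u]) (sq_nonneg u)
  refine (setIntegral_pos_iff_support_of_nonneg_ae (.of_forall h0)
    integrableOn_one_sub_cos_div_sq).2 ?_
  refine lt_of_lt_of_le (b := volume (Set.Ioo (0 : ℝ) 1)) (by simp) (measure_mono ?_)
  intro u hu
  refine ⟨?_, hu.1⟩
  have hc : Real.cos u < 1 := by
    rw [← Real.cos_zero]
    exact Real.cos_lt_cos_of_nonneg_of_le_pi le_rfl (by linarith [hu.2, Real.pi_gt_three]) hu.1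
  exact (div_pos (by linarith) (pow_pos hu.1 2)).ne'

/-- Scaling to a positive multiple of `u`; valid also at `x = 0` and `u = 0`, where division by
zero gives zero on both sides. -/
theorem one_sub_cos_mul_eq (x u : ℝ) :
    (1 - Real.cos (u * x)) / u ^ 2 =
      x ^ 2 * ((1 - Real.cos (|x| * u)) / (|x| * u) ^ 2) := by
  have hc : Real.cos (|x| * u) = Real.cos (u * x) := by
    rcases abs_choice x with h | h <;> rw [h]
    · rw [mul_comm]
    · rw [neg_mul, Real.cos_neg, mul_comm]
  rw [hc, mul_pow, sq_abs]
  by_cases hx : x = 0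
  · simp [hx]
  by_cases hu : u = 0
  · simp [hu]
  field_simp

theorem integrableOn_one_sub_cos_mul (x : ℝ) :
    IntegrableOn (fun u : ℝ => (1 - Real.cos (u * x)) / u ^ 2) (Set.Ioi 0) := by
  by_cases hx : x = 0
  · simp [hx]
  simp only [one_sub_cos_mul_eq x]
  refine Integrable.const_mul ?_ _
  have := (integrableOn_Ioi_comp_mul_left_iff (fun u : ℝ => (1 - Real.cos u) / u ^ 2) 0
    (abs_pos.2 hx)).2 (by simpa using integrableOn_one_sub_cos_div_sq)
  exact this

theorem integral_one_sub_cos_mul (x : ℝ) :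
    ∫ u in Set.Ioi (0 : ℝ), (1 - Real.cos (u * x)) / u ^ 2 = absConst * |x| := by
  by_cases hx : x = 0
  · simp [hx]
  simp only [one_sub_cos_mul_eq x]
  have hx' := abs_pos.2 hx
  rw [integral_const_mul, integral_comp_mul_left_Ioi
    (fun u : ℝ => (1 - Real.cos u) / u ^ 2) 0 hx', mul_zero, smul_eq_mul, ← sq_abs x]
  change |x| ^ 2 * (|x|⁻¹ * absConst) = _
  field_simp

theorem integrableOn_prodExp (m : Fin n → α → ℝ) (g : (Fin n → α) → ℝ) :
    IntegrableOn (fun u : ℝ => prodExp m fun x => (1 - Real.cos (u * g x)) / u ^ 2)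
      (Set.Ioi 0) :=
  integrable_finsetSum _ fun x _ => (integrableOn_one_sub_cos_mul (g x)).const_mul _

theorem integral_prodExp (m : Fin n → α → ℝ) (g : (Fin n → α) → ℝ) :
    ∫ u in Set.Ioi (0 : ℝ), (prodExp m fun x => (1 - Real.cos (u * g x)) / u ^ 2) =
      absConst * prodExp m fun x => |g x| := by
  simp only [prodExp]
  rw [integral_finsetSum _ fun x _ => (integrableOn_one_sub_cos_mul (g x)).const_mul _, mul_sum]
  refine sum_congr rfl fun x _ => ?_
  rw [integral_const_mul, integral_one_sub_cos_mul]
  ring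

/-- The characteristic function of a sum of independent variables with symmetric laws is the
product of their (real) characteristic functions. -/
theorem prodExp_cos_sum (w : Fin n → β → ℝ) (X : β → ℝ) (u : ℝ)
    (hsin : ∀ i, ∑ b, w i b * Real.sin (u * X b) = 0) :
    prodExp w (fun x => Real.cos (u * ∑ i, X (x i))) =
      ∏ i, ∑ b, w i b * Real.cos (u * X b) := by
  have h : ∑ x : Fin n → β, ∏ i, ((w i (x i) : ℂ) * Complex.exp ((u * X (x i) : ℝ) * Complex.I)) =
      ∏ i, ((∑ b, w i b * Real.cos (u * X b) : ℝ) : ℂ) := by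
    rw [← Fintype.prod_sum fun i b => (w i b : ℂ) * Complex.exp ((u * X b : ℝ) * Complex.I)]
    refine prod_congr rfl fun i _ => ?_
    have e : ∀ b, (w i b : ℂ) * Complex.exp ((u * X b : ℝ) * Complex.I) =
        ((w i b * Real.cos (u * X b) : ℝ) : ℂ) +
          ((w i b * Real.sin (u * X b) : ℝ) : ℂ) * Complex.I := fun b => by
      rw [Complex.exp_mul_I, ← Complex.ofReal_cos, ← Complex.ofReal_sin]
      push_cast; ring
    simp only [e, sum_add_distrib, ← sum_mul, ← Complex.ofReal_sum, hsin]
    simp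
  have h2 := congrArg Complex.re h
  rw [← Complex.ofReal_prod, Complex.ofReal_re, Complex.re_sum] at h2
  rw [← h2, prodExp]
  refine sum_congr rfl fun x _ => ?_
  rw [prod_mul_distrib, ← Complex.exp_sum, ← sum_mul, ← Complex.ofReal_sum, ← mul_sum,
    ← Complex.ofReal_prod, Complex.re_ofReal_mul, Complex.exp_ofReal_mul_I_re]

/-- The arithmetic mean of a family of weight vectors. -/
noncomputable def meanWeight {γ : Type*} (w : Fin n → γ → ℝ) (b : γ) : ℝ := (∑ i, w i b) / n

theorem sum_meanWeight_mul (w : Fin n → β → ℝ) (f : β → ℝ) :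
    ∑ b, meanWeight w b * f b = (∑ i, ∑ b, w i b * f b) / n := by
  simp only [meanWeight, div_mul_eq_mul_div, sum_mul, ← sum_div]
  rw [sum_comm]

theorem sum_meanWeight_mul_of_eq (hn : n ≠ 0) (w : Fin n → β → ℝ) (f : β → ℝ) {c : ℝ}
    (h : ∀ i, ∑ b, w i b * f b = c) : ∑ b, meanWeight w b * f b = c := by
  rw [sum_meanWeight_mul, sum_congr rfl fun i _ => h i]
  have : (n : ℝ) ≠ 0 := Nat.cast_ne_zero.2 hn
  simp [this]

theorem sum_meanWeight_of_eq (hn : n ≠ 0) (w : Fin n → β → ℝ) {c : ℝ}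
    (h : ∀ i, ∑ b, w i b = c) : ∑ b, meanWeight w b = c := by
  simpa using sum_meanWeight_mul_of_eq hn w (fun _ => 1) (by simpa using h)

theorem meanWeight_nonneg {γ : Type*} {w : Fin n → γ → ℝ} (hw : ∀ i b, 0 ≤ w i b) (b : γ) :
    0 ≤ meanWeight w b :=
  div_nonneg (sum_nonneg fun i _ => hw i b) (Nat.cast_nonneg n)

/-- The inequality of arithmetic and geometric means. -/
theorem prod_le_mean_pow (z : Fin n → ℝ) (hz : ∀ i, 0 ≤ z i) :
    ∏ i, z i ≤ ((∑ i, z i) / n) ^ n := by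
  rcases Nat.eq_zero_or_pos n with rfl | hn
  · simp
  have hn' : (0 : ℝ) < n := Nat.cast_pos.2 hn
  have h := Real.geom_mean_le_arith_mean univ (fun _ : Fin n => (1 : ℝ)) z
    (fun _ _ => zero_le_one) (by simpa using hn) fun i _ => hz i
  simp only [Real.rpow_one, one_mul, sum_const, card_univ, Fintype.card_fin, nsmul_eq_mul,
    mul_one] at h
  have h' := pow_le_pow_left₀ (Real.rpow_nonneg (prod_nonneg fun i _ => hz i) _) h n
  rwa [Real.rpow_inv_natCast_pow (prod_nonneg fun i _ => hz i) hn.ne'] at h'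

/-- For variables with symmetric laws and nonnegative characteristic functions, replacing all laws
by their mean does not increase `E|∑ Xᵢ|`: `K E|Y| = ∫ (1 - E cos (u Y)) / u² du`, and the
characteristic function of the sum increases by the inequality of means. -/
theorem prodExp_abs_sum_meanWeight_le (hn : n ≠ 0) (w : Fin n → β → ℝ) (X : β → ℝ)
    (h1 : ∀ i, ∑ b, w i b = 1)
    (hsin : ∀ i u, ∑ b, w i b * Real.sin (u * X b) = 0)
    (hcos : ∀ i u, 0 ≤ ∑ b, w i b * Real.cos (u * X b)) :
    prodExp (fun _ : Fin n => meanWeight w) (fun x => |∑ i, X (x i)|) ≤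
      prodExp w (fun x => |∑ i, X (x i)|) := by
  refine le_of_mul_le_mul_left ?_ absConst_pos
  rw [← integral_prodExp, ← integral_prodExp]
  refine setIntegral_mono (integrableOn_prodExp _ _) (integrableOn_prodExp _ _) fun u => ?_
  have e : ∀ v : Fin n → β → ℝ, (∀ i, ∑ b, v i b = 1) →
      (∀ i, ∑ b, v i b * Real.sin (u * X b) = 0) →
      (prodExp v fun x => (1 - Real.cos (u * ∑ i, X (x i))) / u ^ 2) =
        (u ^ 2)⁻¹ * (1 - ∏ i, ∑ b, v i b * Real.cos (u * X b)) := fun v hv hv' => by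
    simp only [div_eq_inv_mul, prodExp_const_mul, prodExp_sub, prodExp_cos_sum v X u hv']
    rw [prodExp_const, prod_congr rfl fun i _ => hv i, prod_const_one, one_mul]
  simp only
  rw [e _ (fun _ => sum_meanWeight_of_eq hn w h1)
    (fun _ => sum_meanWeight_mul_of_eq hn w _ fun i => hsin i u), e w h1 fun i => hsin i u]
  refine mul_le_mul_of_nonneg_left (sub_le_sub_left ?_ 1) (inv_nonneg.2 (sq_nonneg u))
  rw [prod_const, card_univ, Fintype.card_fin, sum_meanWeight_mul]
  exact prod_le_mean_pow _ fun i => hcos i u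

/-- Summation over pairs: the outcomes `x i = (a i, b i)` are split into `a` and `b`. -/
theorem prodExp_pair (w : Fin n → α × α → ℝ) (g : (Fin n → α) → (Fin n → α) → ℝ) :
    prodExp w (fun z => g (fun i => (z i).1) (fun i => (z i).2)) =
      ∑ x : Fin n → α, prodExp (fun i b => w i (x i, b)) (g x) := by
  simp only [prodExp]
  rw [← Fintype.sum_prod_type' (f := fun (x y : Fin n → α) =>
    (∏ i, w i (x i, y i)) * g x y)]
  exact Fintype.sum_equiv (Equiv.arrowProdEquivProdArrow (Fin n) (fun _ => α) (fun _ => α)) _ _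
    fun z => rfl

/-- Conditional Jensen: subtracting conditionally centred variables from the summands does not
decrease the first absolute moment of the sum. -/
theorem prodExp_abs_sum_le_symm (t : α → ℝ) (m : Fin n → α → ℝ) (w : Fin n → α × α → ℝ)
    (hw : ∀ i p, 0 ≤ w i p) (hm : ∀ i a, ∑ b, w i (a, b) = m i a)
    (h0 : ∀ i a, ∑ b, w i (a, b) * t b = 0) :
    prodExp m (fun x => |∑ i, t (x i)|) ≤
      prodExp w (fun z => |∑ i, (t (z i).1 - t (z i).2)|) := by
  rw [prodExp_pair w fun x y => |∑ i, (t (x i) - t (y i))|, prodExp]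
  refine sum_le_sum fun x _ => ?_
  have h : prodExp (fun i b => w i (x i, b)) (fun y => ∑ i, (t (x i) - t (y i))) =
      (∏ i, m i (x i)) * ∑ i, t (x i) := by
    simp only [sum_sub_distrib, prodExp_sub, prodExp_sum, prodExp_const, hm]
    rw [← mul_sum, sum_eq_zero fun j _ => prodExp_eval_eq_zero _ j t (h0 j (x j)), sub_zero]
  have hp : 0 ≤ ∏ i, m i (x i) := prod_nonneg fun i _ => by
    rw [← hm]; exact sum_nonneg fun b _ => hw i _
  rw [← abs_of_nonneg hp, ← abs_mul, ← h]
  refine (abs_sum_le_sum_abs _ _).trans (le_of_eq (sum_congr rfl fun y _ => ?_))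
  rw [abs_mul, abs_of_nonneg (prod_nonneg fun i _ => hw i _)]

theorem prodExp_fst (w : Fin n → α × α → ℝ) (m : Fin n → α → ℝ)
    (hm : ∀ i a, ∑ b, w i (a, b) = m i a) (g : (Fin n → α) → ℝ) :
    prodExp w (fun z => g fun i => (z i).1) = prodExp m g := by
  rw [prodExp_pair w fun x _ => g x, prodExp]
  simp only [prodExp_const, hm]

theorem prodExp_snd (w : Fin n → α × α → ℝ) (m : Fin n → α → ℝ)
    (hm : ∀ i b, ∑ a, w i (a, b) = m i b) (g : (Fin n → α) → ℝ) :
    prodExp w (fun z => g fun i => (z i).2) = prodExp m g := by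
  rw [prodExp_pair w fun _ y => g y]
  simp only [prodExp]
  rw [sum_comm]
  refine sum_congr rfl fun y _ => ?_
  rw [← sum_mul, ← Fintype.prod_sum fun i a => w i (a, y i)]
  simp only [hm]

/-- Sums of independent centred variables versus sums of independent variables with the averaged
law: the first absolute moment at most doubles. Both sums are compared with their symmetrisations,
in which `t(xᵢ)` is replaced by `t(aᵢ) - t(bᵢ)` with `aᵢ`, `bᵢ` independent of the same law, so
that the characteristic functions are nonnegative. -/
theorem prodExp_abs_sum_meanWeight_le_two_mul (hn : n ≠ 0) (t : α → ℝ) (m : Fin n → α → ℝ)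
    (hm : ∀ i a, 0 ≤ m i a) (h1 : ∀ i, ∑ a, m i a = 1) (h0 : ∀ i, ∑ a, m i a * t a = 0) :
    prodExp (fun _ : Fin n => meanWeight m) (fun x => |∑ i, t (x i)|) ≤
      2 * prodExp m (fun x => |∑ i, t (x i)|) := by
  set w : Fin n → α × α → ℝ := fun i p => m i p.1 * m i p.2 with hw
  have hw0 : ∀ i p, 0 ≤ w i p := fun i p => mul_nonneg (hm _ _) (hm _ _)
  have hw1 : ∀ i a, ∑ b, w i (a, b) = m i a := fun i a => by
    simp only [hw, ← mul_sum, h1, mul_one]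
  have hw2 : ∀ i b, ∑ a, w i (a, b) = m i b := fun i b => by
    simp only [hw, ← sum_mul, h1, one_mul]
  have hwt : ∀ i a, ∑ b, w i (a, b) * t b = 0 := fun i a => by
    simp only [hw, mul_assoc, ← mul_sum, h0, mul_zero]
  have hcs : ∀ i u, ∑ p, w i p * Real.cos (u * (t p.1 - t p.2)) =
      (∑ a, m i a * Real.cos (u * t a)) ^ 2 + (∑ a, m i a * Real.sin (u * t a)) ^ 2 := by
    intro i u
    rw [sq, sq, sum_mul_sum, sum_mul_sum, Fintype.sum_prod_type, ← sum_add_distrib]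
    refine sum_congr rfl fun a _ => ?_
    rw [← sum_add_distrib]
    refine sum_congr rfl fun b _ => ?_
    rw [mul_sub, Real.cos_sub, hw]; ring
  have hsn : ∀ i u, ∑ p, w i p * Real.sin (u * (t p.1 - t p.2)) = 0 := by
    intro i u
    have : ∀ p : α × α, w i p * Real.sin (u * (t p.1 - t p.2)) =
        (m i p.1 * Real.sin (u * t p.1)) * (m i p.2 * Real.cos (u * t p.2)) -
        (m i p.1 * Real.cos (u * t p.1)) * (m i p.2 * Real.sin (u * t p.2)) := fun p => by
      rw [mul_sub, Real.sin_sub, hw]; ring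
    simp only [this, sum_sub_distrib, Fintype.sum_prod_type, ← mul_sum, ← sum_mul]
    ring
  have hwm : ∀ i, ∑ p, w i p = 1 := fun i => by
    simp only [Fintype.sum_prod_type, hw1, h1]
  calc prodExp (fun _ : Fin n => meanWeight m) (fun x => |∑ i, t (x i)|)
      ≤ prodExp (fun _ : Fin n => meanWeight w) (fun z => |∑ i, (t (z i).1 - t (z i).2)|) := by
        refine prodExp_abs_sum_le_symm t _ _ (fun _ => meanWeight_nonneg hw0) (fun _ a => ?_)
          fun _ a => ?_
        · simp only [meanWeight, ← sum_div]
          rw [sum_comm]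
          simp only [hw1]
        · simp only [meanWeight, div_mul_eq_mul_div, ← sum_div, sum_mul]
          rw [sum_comm]
          simp only [hwt, sum_const_zero, zero_div]
    _ ≤ prodExp w (fun z => |∑ i, (t (z i).1 - t (z i).2)|) :=
        prodExp_abs_sum_meanWeight_le hn w (fun p => t p.1 - t p.2) hwm hsn fun i u => by
          rw [hcs]; positivity
    _ ≤ prodExp w (fun z => |∑ i, t (z i).1| + |∑ i, t (z i).2|) :=
        prodExp_mono hw0 fun z => by
          rw [sum_sub_distrib]; exact abs_sub _ _
    _ = 2 * prodExp m (fun x => |∑ i, t (x i)|) := by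
        rw [prodExp_add, prodExp_fst w m hw1 fun x => |∑ i, t (x i)|,
          prodExp_snd w m hw2 fun x => |∑ i, t (x i)|]
        ring

/-! ### The comparison for discrete measures -/

/-- `(sinh v - v) / v²` is nondecreasing, by comparison of the power series term by term. -/
theorem sinh_sub_self_le {s v : ℝ} (hs : 0 ≤ s) (hsv : s ≤ v) (hv : 0 < v) :
    Real.sinh s - s ≤ (s / v) ^ 2 * (Real.sinh v - v) := by
  have hsum : ∀ r : ℝ, HasSum (fun k : ℕ => r ^ (2 * k + 1) / ((2 * k + 1).factorial : ℝ) -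
      if k = 0 then r else 0) (Real.sinh r - r) := fun r =>
    (Real.hasSum_sinh r).sub (hasSum_ite_eq 0 r)
  refine hasSum_le (fun k => ?_) (hsum s) ((hsum v).mul_left ((s / v) ^ 2))
  rcases k with _ | k
  · simp
  · simp only [Nat.add_eq_zero_iff, one_ne_zero, and_false, if_false, sub_zero]
    rw [← mul_div_assoc]
    refine div_le_div_of_nonneg_right ?_ (Nat.cast_nonneg _)
    have h1 : s ^ (2 * (k + 1) + 1) = s ^ 2 * s ^ (2 * k + 1) := by ring
    have h2 : (s / v) ^ 2 * v ^ (2 * (k + 1) + 1) = s ^ 2 * v ^ (2 * k + 1) := by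
      rw [div_pow]
      field_simp
      ring
    rw [h1, h2]
    gcongr

/-- The hypothesis bounds `s` in terms of a first absolute moment `A`, as in `sq_variance_le`;
`Delta` is what makes the standard deviation of the remainder at most `Δ(ε) A`. -/
theorem sinh_sub_self_le_Delta_mul_sq {ε s A : ℝ} (hε : 0 < ε) (hs : 0 ≤ s) (hsε : s ≤ 2 * ε)
    (hA : s ^ 2 ≤ A ^ 2 * (1 + 3 * s)) :
    Real.sinh s - s ≤ (Delta ε * A) ^ 2 := by
  have hv : 0 < 2 * ε := by linarith
  have h1 := sinh_sub_self_le hs hsε hv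
  have h2 : 0 ≤ Real.sinh (2 * ε) - 2 * ε := sub_nonneg.2 (Real.self_le_sinh_iff.2 hv.le)
  rw [mul_pow, Delta, Real.sq_sqrt (by positivity)]
  calc Real.sinh s - s ≤ (s / (2 * ε)) ^ 2 * (Real.sinh (2 * ε) - 2 * ε) := h1
    _ = s ^ 2 * ((Real.sinh (2 * ε) - 2 * ε) / (2 * ε) ^ 2) := by field_simp
    _ ≤ (A ^ 2 * (1 + 6 * ε)) * ((Real.sinh (2 * ε) - 2 * ε) / (2 * ε) ^ 2) := by
        refine mul_le_mul_of_nonneg_right (hA.trans ?_) (by positivity)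
        exact mul_le_mul_of_nonneg_left (by linarith) (sq_nonneg A)
    _ = _ := by ring

/-- The discrete counterpart of an admissible measure: nonnegative weights `w` at the points `v`
with `∑ w eᵛ = ∑ w e⁻ᵛ = 1`. -/
structure IsAdmissibleWeight (v w : α → ℝ) : Prop where
  nonneg : ∀ a, 0 ≤ w a
  sum_exp : ∑ a, w a * Real.exp (v a) = 1
  sum_exp_neg : ∑ a, w a * Real.exp (-v a) = 1

theorem IsAdmissibleWeight.sum_cosh {v w : α → ℝ} (h : IsAdmissibleWeight v w) :
    ∑ a, w a * Real.cosh (v a) = 1 := by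
  have : ∀ a, w a * Real.cosh (v a) =
      (w a * Real.exp (v a) + w a * Real.exp (-v a)) / 2 := fun a => by
    rw [Real.cosh_eq]; ring
  simp only [this, ← sum_div, sum_add_distrib, h.sum_exp, h.sum_exp_neg]
  norm_num

theorem IsAdmissibleWeight.sum_sinh {v w : α → ℝ} (h : IsAdmissibleWeight v w) :
    ∑ a, w a * Real.sinh (v a) = 0 := by
  have : ∀ a, w a * Real.sinh (v a) =
      (w a * Real.exp (v a) - w a * Real.exp (-v a)) / 2 := fun a => by
    rw [Real.sinh_eq]; ring
  simp only [this, ← sum_div, sum_sub_distrib, h.sum_exp, h.sum_exp_neg]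
  norm_num

theorem IsAdmissibleWeight.mean (hn : n ≠ 0) {v : α → ℝ} {w : Fin n → α → ℝ}
    (h : ∀ i, IsAdmissibleWeight v (w i)) : IsAdmissibleWeight v (meanWeight w) :=
  ⟨meanWeight_nonneg fun i => (h i).nonneg,
    sum_meanWeight_mul_of_eq hn w _ fun i => (h i).sum_exp,
    sum_meanWeight_mul_of_eq hn w _ fun i => (h i).sum_exp_neg⟩

/-- The weights `w cosh v`. When `w` is the law of half the log-likelihood ratio of two
probability vectors `p`, `q` under `√(pq)`, this is the midpoint `(p + q) / 2`. -/
noncomputable def tilt {γ : Type*} (v w : γ → ℝ) (a : γ) : ℝ := w a * Real.cosh (v a)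

theorem tilt_mul_tanh {γ : Type*} (v w : γ → ℝ) (a : γ) :
    tilt v w a * Real.tanh (v a) = w a * Real.sinh (v a) := by
  rw [tilt, Real.tanh_eq_sinh_div_cosh, mul_assoc, mul_div_cancel₀ _ (Real.cosh_pos _).ne']

theorem tilt_nonneg {v w : α → ℝ} (h : IsAdmissibleWeight v w) (a : α) : 0 ≤ tilt v w a :=
  mul_nonneg (h.nonneg a) (Real.cosh_pos _).le

theorem sum_tilt_mul_tanh {v w : α → ℝ} (h : IsAdmissibleWeight v w) :
    ∑ a, tilt v w a * Real.tanh (v a) = 0 := by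
  simp only [tilt_mul_tanh, h.sum_sinh]

theorem abs_tanh_le_one (x : ℝ) : |Real.tanh x| ≤ 1 :=
  abs_le.2 ⟨(Real.neg_one_lt_tanh x).le, (Real.tanh_lt_one x).le⟩

theorem tilt_meanWeight {γ : Type*} (v : γ → ℝ) (w : Fin n → γ → ℝ) :
    tilt v (meanWeight w) = meanWeight fun i => tilt v (w i) := by
  funext a
  simp only [tilt, meanWeight, ← sum_mul]
  ring

/-- The functional `T` of a convolution of discrete measures with weights `w i` at the points
`v`: the integral of `|sinh|`. -/
noncomputable def discreteT (v : α → ℝ) (w : Fin n → α → ℝ) : ℝ :=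
  prodExp w fun x => |Real.sinh (∑ i, v (x i))|

/-- The product form of `sinh` of a sum, from `e^{± y} = cosh y (1 ± tanh y)`. -/
theorem sinh_sum_eq (y : Fin n → ℝ) :
    Real.sinh (∑ i, y i) = (∏ i, Real.cosh (y i)) *
      ((∏ i, (1 + Real.tanh (y i)) - ∏ i, (1 - Real.tanh (y i))) / 2) := by
  have h1 : ∀ x : ℝ, Real.cosh x * (1 + Real.tanh x) = Real.exp x := fun x => by
    rw [Real.tanh_eq_sinh_div_cosh, mul_add, mul_div_cancel₀ _ (Real.cosh_pos x).ne', mul_one,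
      Real.cosh_add_sinh]
  have h2 : ∀ x : ℝ, Real.cosh x * (1 - Real.tanh x) = Real.exp (-x) := fun x => by
    rw [Real.tanh_eq_sinh_div_cosh, mul_sub, mul_div_cancel₀ _ (Real.cosh_pos x).ne', mul_one,
      Real.cosh_sub_sinh]
  rw [mul_div_assoc', mul_sub, ← prod_mul_distrib, ← prod_mul_distrib]
  simp only [h1, h2]
  rw [← Real.exp_sum, ← Real.exp_sum, sum_neg_distrib, Real.sinh_eq]

theorem discreteT_eq (v : α → ℝ) (w : Fin n → α → ℝ) :
    discreteT v w = prodExp (fun i => tilt v (w i)) fun x =>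
      |(∏ i, (1 + Real.tanh (v (x i))) - ∏ i, (1 - Real.tanh (v (x i)))) / 2| := by
  refine sum_congr rfl fun x _ => ?_
  beta_reduce
  rw [sinh_sum_eq fun i => v (x i), abs_mul, abs_of_pos (prod_pos fun i _ => Real.cosh_pos _),
    ← mul_assoc, ← prod_mul_distrib]
  rfl

/-- Up to an error of the size of the standard deviation `√(sinh s - s)` of the nonlinear part,
`T` is the first absolute moment of the linear part. -/
theorem abs_discreteT_sub_le (v : α → ℝ) (w : Fin n → α → ℝ)
    (h : ∀ i, IsAdmissibleWeight v (w i)) {s : ℝ}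
    (hs : s = ∑ i, ∑ a, tilt v (w i) a * Real.tanh (v a) ^ 2) :
    |discreteT v w - prodExp (fun i => tilt v (w i)) (fun x => |∑ i, Real.tanh (v (x i))|)| ≤
      Real.sqrt (Real.sinh s - s) := by
  set m : Fin n → α → ℝ := fun i => tilt v (w i) with hm
  set t : α → ℝ := fun a => Real.tanh (v a) with ht
  have hm0 : ∀ i a, 0 ≤ m i a := fun i => tilt_nonneg (h i)
  have hm1 : ∀ i, ∑ a, m i a = 1 := fun i => (h i).sum_cosh
  set D : (Fin n → α) → ℝ := fun x => (∏ i, (1 + t (x i)) - ∏ i, (1 - t (x i))) / 2 with hD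
  set S : (Fin n → α) → ℝ := fun x => ∑ i, t (x i) with hS
  have hR : prodExp m (fun x => |D x - S x|) ≤ Real.sqrt (Real.sinh s - s) := by
    refine Real.le_sqrt_of_sq_le ((prodExp_abs_sq_le hm0 hm1 _).trans ?_)
    exact prodExp_remainder_sq_le t (fun a => abs_tanh_le_one _) m hm0 hm1
      (fun i => sum_tilt_mul_tanh (h i)) hs
  rw [discreteT_eq]
  change |prodExp m (fun x => |D x|) - prodExp m (fun x => |S x|)| ≤ _
  have u1 := prodExp_mono hm0 (f := fun x => |D x|) (g := fun x => |S x| + |D x - S x|)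
    fun x => by linarith [abs_sub_abs_le_abs_sub (D x) (S x)]
  have u2 := prodExp_mono hm0 (f := fun x => |S x|) (g := fun x => |D x| + |D x - S x|)
    fun x => by linarith [abs_sub_abs_le_abs_sub (S x) (D x), abs_sub_comm (S x) (D x)]
  rw [prodExp_add] at u1 u2
  exact abs_le.2 ⟨by linarith, by linarith⟩

/-- The regime of small variance: both sides are compared with their linear parts. -/
theorem discreteT_mean_le_of_variance_le (hn : n ≠ 0) (v : α → ℝ) (w : Fin n → α → ℝ)
    (h : ∀ i, IsAdmissibleWeight v (w i)) {ε : ℝ} (hε : 0 < ε) (hΔ : Delta ε < 1)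
    (hs : ∑ i, ∑ a, tilt v (w i) a * Real.tanh (v a) ^ 2 ≤ 2 * ε) :
    discreteT v (fun _ : Fin n => meanWeight w) ≤
      (2 + Delta ε) / (1 - Delta ε) * discreteT v w := by
  set s := ∑ i, ∑ a, tilt v (w i) a * Real.tanh (v a) ^ 2 with hsdef
  have hn' : (n : ℝ) ≠ 0 := Nat.cast_ne_zero.2 hn
  have hs' : s = ∑ i : Fin n, ∑ a, tilt v (meanWeight w) a * Real.tanh (v a) ^ 2 := by
    rw [sum_const, card_univ, Fintype.card_fin, tilt_meanWeight, sum_meanWeight_mul, nsmul_eq_mul,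
      mul_div_cancel₀ _ hn']
  have hs0 : 0 ≤ s := sum_nonneg fun i _ => sum_nonneg fun a _ =>
    mul_nonneg (tilt_nonneg (h i) a) (sq_nonneg _)
  have a1 := abs_le.1 (abs_discreteT_sub_le v w h hsdef)
  have a2 := abs_le.1 (abs_discreteT_sub_le v (fun _ : Fin n => meanWeight w)
    (fun _ => IsAdmissibleWeight.mean hn h) hs')
  have a3 := prodExp_abs_sum_meanWeight_le_two_mul hn (fun a => Real.tanh (v a))
    (fun i => tilt v (w i)) (fun i => tilt_nonneg (h i)) (fun i => (h i).sum_cosh)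
    fun i => sum_tilt_mul_tanh (h i)
  have a4 := sq_variance_le (fun a => Real.tanh (v a)) (fun a => abs_tanh_le_one _)
    (fun i => tilt v (w i)) (fun i => tilt_nonneg (h i)) (fun i => (h i).sum_cosh)
    (fun i => sum_tilt_mul_tanh (h i)) hsdef
  rw [← tilt_meanWeight] at a3
  have hA0 : 0 ≤ prodExp (fun i => tilt v (w i)) fun x => |∑ i, Real.tanh (v (x i))| :=
    prodExp_nonneg (fun i => tilt_nonneg (h i)) fun x => abs_nonneg _
  set A := prodExp (fun i => tilt v (w i)) fun x => |∑ i, Real.tanh (v (x i))|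
  have hΔ0 : 0 ≤ Delta ε := Real.sqrt_nonneg _
  have hr : Real.sqrt (Real.sinh s - s) ≤ Delta ε * A :=
    Real.sqrt_le_iff.2 ⟨mul_nonneg hΔ0 hA0, sinh_sub_self_le_Delta_mul_sq hε hs0 hs a4⟩
  have b1 : (1 - Delta ε) * A ≤ discreteT v w := by linarith [a1.1]
  have b2 : discreteT v (fun _ : Fin n => meanWeight w) ≤ (2 + Delta ε) * A := by
    linarith [a2.2]
  rw [div_mul_eq_mul_div, le_div_iff₀ (by linarith)]
  nlinarith [mul_le_mul_of_nonneg_right b2 (by linarith : 0 ≤ 1 - Delta ε),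
    mul_le_mul_of_nonneg_left b1 (by linarith : 0 ≤ 2 + Delta ε)]

theorem prodExp_cosh_sum {v : α → ℝ} {w : Fin n → α → ℝ}
    (h : ∀ i, IsAdmissibleWeight v (w i)) :
    prodExp w (fun x => Real.cosh (∑ i, v (x i))) = 1 := by
  have e : (fun x : Fin n → α => Real.cosh (∑ i, v (x i))) = fun x =>
      1 / 2 * ∏ i, Real.exp (v (x i)) + 1 / 2 * ∏ i, Real.exp (-v (x i)) := by
    funext x
    rw [← Real.exp_sum, ← Real.exp_sum, sum_neg_distrib, Real.cosh_eq]; ring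
  rw [e, prodExp_add, prodExp_const_mul, prodExp_const_mul,
    prodExp_prod w fun _ a => Real.exp (v a), prodExp_prod w fun _ a => Real.exp (-v a),
    prod_congr rfl fun i _ => (h i).sum_exp, prod_congr rfl fun i _ => (h i).sum_exp_neg]
  norm_num

/-- The lower bound of the total variation distance by the Hellinger affinity. -/
theorem one_sub_prod_le_discreteT {v : α → ℝ} {w : Fin n → α → ℝ}
    (h : ∀ i, IsAdmissibleWeight v (w i)) : 1 - ∏ i, ∑ a, w i a ≤ discreteT v w := by
  have h1 := prodExp_mono (fun i => (h i).nonneg)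
    (f := fun x => Real.cosh (∑ i, v (x i)) - 1) (g := fun x => |Real.sinh (∑ i, v (x i))|)
    fun x => by
      have := Real.cosh_sub_sinh |∑ i, v (x i)|
      rw [Real.cosh_abs, ← Real.abs_sinh] at this
      have h2 : Real.exp (-|∑ i, v (x i)|) ≤ 1 := Real.exp_le_one_iff.2 (by simp)
      linarith
  rwa [prodExp_sub, prodExp_cosh_sum h, prodExp_const, mul_one] at h1

/-- The upper bound of the total variation distance by the Hellinger affinity: Cauchy-Schwarz
applied to `sinh² = (cosh - 1) (cosh + 1)`. -/
theorem discreteT_sq_le {v : α → ℝ} {w : Fin n → α → ℝ}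
    (h : ∀ i, IsAdmissibleWeight v (w i)) :
    discreteT v w ^ 2 ≤ 1 - (∏ i, ∑ a, w i a) ^ 2 := by
  have h1 := prodExp_mul_sq_le (fun i => (h i).nonneg)
    (f := fun x => Real.cosh (∑ i, v (x i)) - 1) (g := fun x => Real.cosh (∑ i, v (x i)) + 1)
    (h := fun x => |Real.sinh (∑ i, v (x i))|)
    (fun x => by linarith [Real.one_le_cosh (∑ i, v (x i))])
    (fun x => by linarith [Real.one_le_cosh (∑ i, v (x i))])
    (fun x => by
      rw [sq_abs, Real.sinh_sq]; exact le_of_eq (by ring))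
  rw [prodExp_sub, prodExp_add, prodExp_cosh_sum h, prodExp_const, mul_one] at h1
  change discreteT v w ^ 2 ≤ _ at h1
  linarith

/-- The affinity of a factor is controlled by its variance: under the tilted weights the mass of
`w` is the mean of `1 / cosh = √(1 - tanh²) ≤ 1 - tanh² / 2`. -/
theorem IsAdmissibleWeight.sum_le {v w : α → ℝ} (h : IsAdmissibleWeight v w) :
    ∑ a, w a ≤ Real.exp (-((∑ a, tilt v w a * Real.tanh (v a) ^ 2) / 2)) := by
  refine le_trans ?_ (Real.one_sub_le_exp_neg _)
  have key : ∑ a, w a ≤ ∑ a, (tilt v w a - tilt v w a * Real.tanh (v a) ^ 2 / 2) := by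
    refine sum_le_sum fun a _ => ?_
    have hc := Real.cosh_pos (v a)
    have e : tilt v w a - tilt v w a * Real.tanh (v a) ^ 2 / 2 - w a =
        w a * ((Real.cosh (v a) - 1) ^ 2 / (2 * Real.cosh (v a))) := by
      rw [tilt, Real.tanh_eq_sinh_div_cosh, div_pow, Real.sinh_sq]
      field_simp
      ring
    have := mul_nonneg (h.nonneg a) (by positivity :
      0 ≤ (Real.cosh (v a) - 1) ^ 2 / (2 * Real.cosh (v a)))
    linarith
  rw [sum_sub_distrib, ← sum_div] at key
  have h1 : ∑ a, tilt v w a = 1 := h.sum_cosh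
  linarith

/-- The regime of small affinity: only the bounds of `T` by the Hellinger affinity are used, and
the affinity of the averaged product is the larger one. -/
theorem discreteT_mean_le_of_affinity_le (hn : n ≠ 0) (v : α → ℝ) (w : Fin n → α → ℝ)
    (h : ∀ i, IsAdmissibleWeight v (w i)) {ε : ℝ} (hε : 0 < ε)
    (hr : ∏ i, ∑ a, w i a ≤ Real.exp (-ε)) :
    discreteT v (fun _ : Fin n => meanWeight w) ≤
      Real.sqrt ((1 + Real.exp (-ε)) / (1 - Real.exp (-ε))) * discreteT v w := by
  have l1 := one_sub_prod_le_discreteT h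
  have l2 := discreteT_sq_le (v := v) (w := fun _ : Fin n => meanWeight w)
    fun _ => IsAdmissibleWeight.mean hn h
  have hw0 : ∀ i, 0 ≤ ∑ a, w i a := fun i => sum_nonneg fun a _ => (h i).nonneg a
  have hr0 : 0 ≤ ∏ i, ∑ a, w i a := prod_nonneg fun i _ => hw0 i
  have l3 : ∏ i, ∑ a, w i a ≤ ∏ _i : Fin n, ∑ a, meanWeight w a := by
    have e : ∑ a, meanWeight w a = (∑ i, ∑ a, w i a) / n := by
      simpa using sum_meanWeight_mul w fun _ => 1
    rw [prod_const, card_univ, Fintype.card_fin, e]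
    exact prod_le_mean_pow _ hw0
  set r := ∏ i, ∑ a, w i a
  set q := Real.exp (-ε)
  have hq : q < 1 := (Real.exp_lt_one_iff).2 (by linarith)
  have hq0 : 0 < q := Real.exp_pos _
  have hT : 0 ≤ discreteT v w := by linarith
  rw [← Real.sqrt_sq hT, ← Real.sqrt_mul' _ (sq_nonneg _)]
  refine Real.le_sqrt_of_sq_le (l2.trans ?_)
  have h3 : r ^ 2 ≤ (∏ _i : Fin n, ∑ a, meanWeight w a) ^ 2 := pow_le_pow_left₀ hr0 l3 2
  have h4 : (1 - r) ^ 2 ≤ discreteT v w ^ 2 := pow_le_pow_left₀ (by linarith) l1 2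
  have h5 : (1 + r) ≤ (1 + q) / (1 - q) * (1 - r) := by
    rw [div_mul_eq_mul_div, le_div_iff₀ (by linarith)]
    nlinarith
  have h6 : 0 ≤ (1 + q) / (1 - q) := div_nonneg (by linarith) (by linarith)
  calc 1 - (∏ _i : Fin n, ∑ a, meanWeight w a) ^ 2 ≤ (1 + r) * (1 - r) := by linarith
    _ ≤ (1 + q) / (1 - q) * (1 - r) * (1 - r) :=
        mul_le_mul_of_nonneg_right h5 (by linarith)
    _ = (1 + q) / (1 - q) * (1 - r) ^ 2 := by ring
    _ ≤ _ := mul_le_mul_of_nonneg_left h4 h6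

theorem discreteT_nonneg {v : α → ℝ} {w : Fin n → α → ℝ}
    (h : ∀ i, IsAdmissibleWeight v (w i)) : 0 ≤ discreteT v w :=
  prodExp_nonneg (fun i => (h i).nonneg) fun _ => abs_nonneg _

theorem discreteT_mean_le (hn : n ≠ 0) (v : α → ℝ) (w : Fin n → α → ℝ)
    (h : ∀ i, IsAdmissibleWeight v (w i)) {ε : ℝ} (hε : 0 < ε) (hΔ : Delta ε < 1) :
    discreteT v (fun _ : Fin n => meanWeight w) ≤ C ε * discreteT v w := by
  have hT := discreteT_nonneg h
  rcases le_or_gt (∏ i, ∑ a, w i a) (Real.exp (-ε)) with hr | hr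
  · exact (discreteT_mean_le_of_affinity_le hn v w h hε hr).trans
      (mul_le_mul_of_nonneg_right (le_max_right _ _) hT)
  · have hs : ∏ i, ∑ a, w i a ≤
        Real.exp (-((∑ i, ∑ a, tilt v (w i) a * Real.tanh (v a) ^ 2) / 2)) := by
      rw [sum_div, ← sum_neg_distrib, Real.exp_sum]
      exact prod_le_prod (fun i _ => sum_nonneg fun a _ => (h i).nonneg a) fun i _ => (h i).sum_le
    have hs' := Real.exp_lt_exp.1 (hr.trans_le hs)
    refine (discreteT_mean_le_of_variance_le hn v w h hε hΔ (by linarith)).trans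
      (mul_le_mul_of_nonneg_right (le_trans ?_ (le_max_left _ _)) hT)
    -- The small-variance constant `(2 + Δ) / (1 - Δ)` is weakened to `(4√2 + Δ) / (1 - Δ)`.
    have : (1 : ℝ) ≤ Real.sqrt 2 := Real.one_le_sqrt.2 (by norm_num)
    exact div_le_div_of_nonneg_right (by linarith) (by linarith)

/-! ### From measures to weights, and the constant -/

theorem integral_eq_sum_of_ae_mem_range {Ω : Type*} [MeasurableSpace Ω]
    [MeasurableSingletonClass Ω] (μ : Measure Ω) [IsFiniteMeasure μ] {φ : α → Ω}
    (hφ : Function.Injective φ) (h : ∀ᵐ x ∂μ, x ∈ Set.range φ) (f : Ω → ℝ) :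
    ∫ x, f x ∂μ = ∑ k, μ.real {φ k} * f (φ k) := by
  classical
  have hc : ((univ.image φ : Finset Ω) : Set Ω) = Set.range φ := by simp
  rw [← Measure.restrict_eq_self_of_ae_mem h, ← hc, setIntegral_finset _ IntegrableOn.finset,
    sum_image fun a _ b _ hab => hφ hab, hc, Measure.restrict_eq_self_of_ae_mem h]
  rfl

theorem T_eq (μ : Measure ℝ) : T μ = ∫ x, |Real.sinh x| ∂μ := by
  rw [T, ← integral_const_mul]
  refine integral_congr_ae (.of_forall fun x => ?_)
  simp only [Real.sinh_eq, abs_div]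
  norm_num
  ring

/-- For measures carried by a finite set, `T` of the convolution is a finite sum over the
atoms. -/
theorem T_familyConv_eq {S : Finset ℝ} (η : Fin n → Measure ℝ) [∀ i, IsFiniteMeasure (η i)]
    (hS : ∀ i, ∀ᵐ x ∂η i, x ∈ S) :
    T (familyConv η) = discreteT (fun a : S => (a : ℝ)) fun i a => (η i).real {(a : ℝ)} := by
  have hmeas : Measurable fun x : Fin n → ℝ => ∑ i, x i := by fun_prop
  rw [T_eq, familyConv, integral_map hmeas.aemeasurable
    (Real.continuous_sinh.abs.aestronglyMeasurable)]
  have hφ : Function.Injective fun (x : Fin n → S) i => (x i : ℝ) := fun x y h =>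
    funext fun i => Subtype.ext (congrFun h i)
  have hr : ∀ᵐ x ∂Measure.pi η, x ∈ Set.range fun (x : Fin n → S) i => (x i : ℝ) := by
    have := ae_all_iff.2 fun i => Measure.tendsto_eval_ae_ae.eventually (hS i)
    filter_upwards [this] with x hx
    exact ⟨fun i => ⟨x i, hx i⟩, rfl⟩
  rw [integral_eq_sum_of_ae_mem_range _ hφ hr]
  refine sum_congr rfl fun x _ => ?_
  rw [measureReal_def, Measure.pi_singleton, ENNReal.toReal_prod]
  rfl

theorem isAdmissibleWeight_of_isAdmissible {S : Finset ℝ} {η : Measure ℝ} (h : IsAdmissible η)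
    (hS : ∀ᵐ x ∂η, x ∈ S) :
    IsAdmissibleWeight (fun a : S => (a : ℝ)) fun a => η.real {(a : ℝ)} := by
  have := h.isFiniteMeasure
  have hr : ∀ᵐ x ∂η, x ∈ Set.range ((↑) : S → ℝ) := by simpa using hS
  refine ⟨fun a => measureReal_nonneg, ?_, ?_⟩
  · rw [← h.integral_exp, integral_eq_sum_of_ae_mem_range η Subtype.val_injective hr]
  · rw [← h.integral_exp_neg, integral_eq_sum_of_ae_mem_range η Subtype.val_injective hr]

theorem mean_real_apply (η : Fin n → Measure ℝ) [∀ i, IsFiniteMeasure (η i)] (s : Set ℝ) :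
    (mean η).real s = meanWeight (fun i (t : Set ℝ) => (η i).real t) s := by
  rw [mean, measureReal_ennreal_smul_apply, meanWeight, measureReal_def, Measure.finsetSum_apply,
    ENNReal.toReal_sum fun i _ => measure_ne_top _ _, ENNReal.toReal_inv, ENNReal.toReal_natCast,
    div_eq_inv_mul]
  rfl

theorem isFiniteMeasure_mean (hn : n ≠ 0) (η : Fin n → Measure ℝ) [∀ i, IsFiniteMeasure (η i)] :
    IsFiniteMeasure (mean η) := by
  refine ⟨?_⟩
  rw [mean, Measure.smul_apply, smul_eq_mul]
  exact ENNReal.mul_lt_top (by simp [Nat.pos_of_ne_zero hn]) (measure_lt_top _ _)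

theorem ae_mean {η : Fin n → Measure ℝ} {p : ℝ → Prop} (h : ∀ i, ∀ᵐ x ∂η i, p x) :
    ∀ᵐ x ∂mean η, p x := by
  rw [ae_iff, mean, Measure.smul_apply, Measure.finsetSum_apply,
    sum_eq_zero fun i _ => ae_iff.1 (h i), smul_zero]

theorem exists_finset_forall_ae_mem {η : Fin n → Measure ℝ} (h : ∀ i, IsAdmissible (η i)) :
    ∃ S : Finset ℝ, ∀ i, ∀ᵐ x ∂η i, x ∈ S := by
  classical
  choose s hs h0 using fun i => (h i).finite_support
  refine ⟨univ.biUnion fun i => (hs i).toFinset, fun i => ?_⟩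
  filter_upwards [compl_mem_ae_iff.2 (h0 i)] with x hx
  simp only [compl_compl] at hx
  simpa using ⟨i, hx⟩

theorem T_convPower_mean_le (hn : n ≠ 0) {η : Fin n → Measure ℝ} (h : ∀ i, IsAdmissible (η i))
    {ε : ℝ} (hε : 0 < ε) (hΔ : Delta ε < 1) :
    T (convPower (mean η) n) ≤ C ε * T (familyConv η) := by
  have hf : ∀ i, IsFiniteMeasure (η i) := fun i => (h i).isFiniteMeasure
  have hf' := isFiniteMeasure_mean hn η
  obtain ⟨S, hS⟩ := exists_finset_forall_ae_mem h
  rw [convPower, T_familyConv_eq _ hS, T_familyConv_eq _ fun _ => ae_mean hS]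
  simp only [mean_real_apply]
  exact discreteT_mean_le hn _ _ (fun i => isAdmissibleWeight_of_isAdmissible (h i) (hS i)) hε hΔ

theorem T_nonneg (μ : Measure ℝ) : 0 ≤ T μ :=
  mul_nonneg (by norm_num) (integral_nonneg fun _ => abs_nonneg _)

theorem C_nonneg (ε : ℝ) : 0 ≤ C ε :=
  (Real.sqrt_nonneg _).trans (le_max_right _ _)

/-- At this `ε` the two terms of the maximum `C ε` nearly coincide. -/
theorem Delta_lt : Delta (4439 / 100000) < 0.136914 := by
  rw [Delta, Real.sqrt_lt' (by norm_num)]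
  have h1 := abs_le.1 (Real.exp_bound (x := 4439 / 50000) (by norm_num [abs_of_pos])
    (n := 7) (by norm_num))
  have h2 := abs_le.1 (Real.exp_bound (x := -(4439 / 50000)) (by norm_num [abs_of_pos])
    (n := 7) (by norm_num))
  norm_num [Finset.sum_range_succ, Nat.factorial, abs_of_pos] at h1 h2
  have e : (2 * (4439 / 100000) : ℝ) = 4439 / 50000 := by norm_num
  rw [e, Real.sinh_eq]
  have h3 : Real.exp (4439 / 50000) - Real.exp (-(4439 / 50000)) <
      2 * (4439 / 50000 + 0.000116673) := by
    norm_num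
    linarith [h1.2, h2.1]
  norm_num at h3 ⊢
  linarith

theorem C_lt : C (4439 / 100000) < 6.7129 := by
  have hΔ := Delta_lt
  refine max_lt ?_ ?_
  · have h2 : Real.sqrt 2 < 1.4142136 := by
      rw [Real.sqrt_lt' (by norm_num)]; norm_num
    rw [div_lt_iff₀ (by linarith)]
    linarith
  · have h1 := abs_le.1 (Real.exp_bound (x := -(4439 / 100000)) (by norm_num [abs_of_pos])
      (n := 6) (by norm_num))
    norm_num [Finset.sum_range_succ, Nat.factorial, abs_of_pos] at h1
    rw [Real.sqrt_lt' (by norm_num)]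
    have hq : Real.exp (-(4439 / 100000)) < 0.95658083 := by
      norm_num
      linarith [h1.2]
    rw [div_lt_iff₀ (by linarith)]
    norm_num at hq ⊢
    linarith

theorem nonempty_CValues : CValues.Nonempty :=
  ⟨_, 4439 / 100000, by norm_num, Delta_lt.trans (by norm_num), rfl⟩

theorem bddBelow_CValues : BddBelow CValues :=
  ⟨0, by rintro _ ⟨ε, -, -, rfl⟩; exact C_nonneg ε⟩

theorem C₀_lt : C₀ < 6.7129 :=
  (csInf_le bddBelow_CValues
    ⟨4439 / 100000, by norm_num, Delta_lt.trans (by norm_num), rfl⟩).trans_lt C_lt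

/-- A bound that holds for every `C ε` passes to the infimum. -/
theorem le_C₀_mul {x y : ℝ} (hy : 0 ≤ y) (h : ∀ c ∈ CValues, x ≤ c * y) : x ≤ C₀ * y := by
  rcases hy.eq_or_lt with rfl | hpos
  · obtain ⟨c, hc⟩ := nonempty_CValues
    simpa using h c hc
  · rw [← div_le_iff₀ hpos]
    exact le_csInf nonempty_CValues fun c hc => (div_le_iff₀ hpos).2 (h c hc)

end AdmissibleConv

theorem theorem2 :
    IsGLB AdmissibleConv.CValues AdmissibleConv.C₀ ∧
    AdmissibleConv.C₀ < 6.7129 ∧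
    ∀ (n : ℕ), 1 ≤ n → ∀ (η : Fin n → MeasureTheory.Measure ℝ),
      (∀ i, AdmissibleConv.IsAdmissible (η i)) →
        AdmissibleConv.T (AdmissibleConv.convPower (AdmissibleConv.mean η) n) ≤
          AdmissibleConv.C₀ * AdmissibleConv.T (AdmissibleConv.familyConv η) := by
  refine ⟨isGLB_csInf AdmissibleConv.nonempty_CValues AdmissibleConv.bddBelow_CValues,
    AdmissibleConv.C₀_lt, fun n hn η h => ?_⟩
  refine AdmissibleConv.le_C₀_mul (AdmissibleConv.T_nonneg _) ?_
  rintro _ ⟨ε, hε, hΔ, rfl⟩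
  exact AdmissibleConv.T_convPower_mean_le (Nat.one_le_iff_ne_zero.1 hn) h hε hΔ
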